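/- A 2-complex $X$ is taken combinatorially: it has 0-cells, 1-cells and 2-cells $r$, and each 2-cell $r$ is attached along a closed edge path $w_r$ of positive length that is immersed (it has no backtrack, also cyclically). Let $W=\bigsqcup_r w_r$ be the disjoint union of the boundary circles and $\Phi:W\to X^1$ the map to the 1-skeleton induced by the attaching maps. A *stacking* of $X$ is a continuous injection $\Psi:W\to X^1\times\mathbb R$ whose composition with the projection to $X^1$ is $\Phi$; write $\eta:W\to\mathbb R$ for its second coordinate. The stacking is *good* if for each 2-cell $r$ there are points $\ell_r,h_r\in w_r$ such that $\eta(\ell_r)$ is the least element of $\eta(\Phi^{-1}(\Phi(\ell_r)))$ and $\eta(h_r)$ is the greatest element of $\eta(\Phi^{-1}(\Phi(h_r)))$. A *side* of a 2-cell $r$ at a 1-cell $e$ is an arc of $w_r$ that traverses $e$. Of two distinct sides at the same 1-cell $e$, one is lower than the other, meaning that $\eta$ is smaller on it over each interior point of $e$. The *directed dual graph* $\Gamma$ of $X$ with respect to the stacking has the 2-cells as its vertices, and for each two distinct sides at a common 1-cell an edge directed from the 2-cell of the lower side to the 2-cell of the higher side. **Theorem.** Let $\widetilde X$ be a simply-connected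 2-complex with a good stacking. Then its directed dual graph $\Gamma$ is acyclic, i.e. it has no directed cycle (of length $\ge 1$). -/

import Mathlib

open unitInterval

universe u v w

/-- A combinatorial 1-complex (graph): 0-cells `V`, 1-cells `E`, each 1-cell running from its
source to its target. Loops and multiple edges are allowed. -/
structure OneComplex (V : Type u) (E : Type v) where
  src : E → V
  tgt : E → V

namespace OneComplex

variable {V : Type u} {E : Type v} (G : OneComplex V E)

/-- The gluing of the ends of the intervals `{e} × [0,1]` to the 0-cells. -/
inductive Glue : V ⊕ (E × I) → V ⊕ (E × I) → Prop
  | atSrc (e : E) : Glue (Sum.inr (e, 0)) (Sum.inl (G.src e))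
  | atTgt (e : E) : Glue (Sum.inr (e, 1)) (Sum.inl (G.tgt e))

/-- The topological space underlying a 1-complex. -/
def Realization : Type (max u v) := Quot G.Glue

/-- The point of the realization given by a 0-cell. -/
def vertexPoint (x : V) : G.Realization := Quot.mk _ (Sum.inl x)

/-- The characteristic map of a 1-cell. -/
def edgePoint (e : E) (t : I) : G.Realization := Quot.mk _ (Sum.inr (e, t))

/-- The weak topology: a set is open iff its preimage under the characteristic map
of every 1-cell is open in the unit interval. -/
instance : TopologicalSpace G.Realization :=
  ⨆ e : E, TopologicalSpace.coinduced (G.edgePoint e) inferInstance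

/-- An oriented 1-cell `(e, true)` is `e` traversed forwards, `(e, false)` is `e` traversed
backwards. This is its initial 0-cell. -/
def start (d : E × Bool) : V := if d.2 then G.src d.1 else G.tgt d.1

/-- The terminal 0-cell of an oriented 1-cell. -/
def finish (d : E × Bool) : V := if d.2 then G.tgt d.1 else G.src d.1

/-- `G.IsPath x p y`: the list `p` of oriented 1-cells is an edge path from `x` to `y`. -/
inductive IsPath : V → List (E × Bool) → V → Prop
  | nil (x : V) : IsPath x [] x
  | cons (d : E × Bool) (p : List (E × Bool)) (y : V) (h : IsPath (G.finish d) p y) :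
      IsPath (G.start d) (d :: p) y

end OneComplex

/-- The parameter `t` or `1 - t`, according to a direction of traversal. -/
def orientParam (b : Bool) (t : I) : I := if b then t else σ t

/-- A combinatorial 2-complex with 0-cells `V`, 1-cells `E`, 2-cells `F`. The boundary path of a
2-cell `r` is a closed edge path of length `len r > 0`, whose successive oriented 1-cells are
`side r i`, `i` in `ℤ / len r`; it is immersed, i.e. it has no backtrack, also cyclically. -/
structure TwoComplex (V : Type u) (E : Type v) (F : Type w) extends OneComplex V E where
  len : F → ℕ
  len_pos : ∀ r, 0 < len r
  side : (r : F) → ZMod (len r) → E × Bool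
  closed : ∀ r i, toOneComplex.finish (side r i) = toOneComplex.start (side r (i + 1))
  immersed : ∀ r i, side r (i + 1) ≠ ((side r i).1, !(side r i).2)

namespace TwoComplex

variable {V : Type u} {E : Type v} {F : Type w} (X : TwoComplex V E F)

/-! ### Simple connectivity -/

/-- The boundary path of the 2-cell `r`, read once around from its `i`-th corner. -/
def boundaryPath (r : F) (i : ZMod (X.len r)) : List (E × Bool) :=
  List.ofFn fun k : Fin (X.len r) => X.side r (i + (k : ℕ))

/-- The elementary moves: inserting a backtrack, and inserting the boundary path of a 2-cell. -/
inductive Insertion : List (E × Bool) → List (E × Bool) → Prop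
  | backtrack (p q : List (E × Bool)) (e : E) (b : Bool) :
      Insertion (p ++ q) (p ++ [(e, b), (e, !b)] ++ q)
  | cell (p q : List (E × Bool)) (r : F) (i : ZMod (X.len r)) :
      Insertion (p ++ q) (p ++ X.boundaryPath r i ++ q)

/-- Homotopy rel endpoints of edge paths from `x` to `y`: the equivalence relation generated by
the elementary moves between such paths. -/
def Homotopic (x y : V) : List (E × Bool) → List (E × Bool) → Prop :=
  Relation.EqvGen fun p q =>
    X.toOneComplex.IsPath x p y ∧ X.toOneComplex.IsPath x q y ∧ X.Insertion p q

/-- A 2-complex is simply connected if it is nonempty and connected and each closed edge path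
is null-homotopic. -/
def IsSimplyConnected : Prop :=
  Nonempty V ∧ (∀ x y : V, ∃ p, X.toOneComplex.IsPath x p y) ∧
    ∀ (x : V) (p : List (E × Bool)), X.toOneComplex.IsPath x p x → X.Homotopic x x p []

/-! ### The boundary circles and the attaching map -/

/-- The sides of the 2-cells, one for each traversal of a 1-cell by a boundary path; the same type
indexes the corners, the `i`-th corner of `r` being where its `i`-th side begins. -/
abbrev Side : Type w := Σ r : F, ZMod (X.len r)

/-- The 1-cell over which a side lies. -/
def under (s : X.Side) : E := (X.side s.1 s.2).1

/-- The disjoint union `W` of the boundary circles of the 2-cells, as a 1-complex: the circle of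
`r` is subdivided into `len r` arcs, its sides. -/
def circles : OneComplex X.Side X.Side where
  src s := s
  tgt s := ⟨s.1, s.2 + 1⟩

/-- The map `Φ : W → X¹` induced by the attaching maps of the 2-cells: the `i`-th arc of the
circle of `r` traverses the oriented 1-cell `side r i`. -/
def attach : X.circles.Realization → X.toOneComplex.Realization :=
  Quot.lift
    (Sum.elim
      (fun c => X.toOneComplex.vertexPoint (X.toOneComplex.start (X.side c.1 c.2)))
      (fun st => X.toOneComplex.edgePoint (X.under st.1)
        (orientParam (X.side st.1.1 st.1.2).2 st.2)))
    (by
      have h0 : ∀ e, X.toOneComplex.edgePoint e 0 =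
          X.toOneComplex.vertexPoint (X.src e) :=
        fun e => Quot.sound (OneComplex.Glue.atSrc e)
      have h1 : ∀ e, X.toOneComplex.edgePoint e 1 =
          X.toOneComplex.vertexPoint (X.tgt e) :=
        fun e => Quot.sound (OneComplex.Glue.atTgt e)
      rintro _ _ (s | s)
      · cases hb : (X.side s.1 s.2).2 <;>
          simp [orientParam, OneComplex.start, circles, under, hb, h0, h1]
      · have hc := X.closed s.1 s.2
        simp only [Sum.elim_inr, Sum.elim_inl, circles]
        rw [← hc]
        cases hb : (X.side s.1 s.2).2 <;>
          simp [orientParam, OneComplex.finish, under, hb, h0, h1])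

/-- The boundary circle of the 2-cell `r`, as a part of `W`. -/
def circle (r : F) : Set X.circles.Realization :=
  {p | ∃ (i : ZMod (X.len r)) (t : I), p = X.circles.edgePoint ⟨r, i⟩ t}

/-- The point of the side `s` that lies over the point with parameter `t` of its 1-cell. -/
def sidePoint (s : X.Side) (t : I) : X.circles.Realization :=
  X.circles.edgePoint s (orientParam (X.side s.1 s.2).2 t)

theorem attach_sidePoint (s : X.Side) (t : I) :
    X.attach (X.sidePoint s t) = X.toOneComplex.edgePoint (X.under s) t := by
  change X.toOneComplex.edgePoint (X.under s)
    (orientParam (X.side s.1 s.2).2 (orientParam (X.side s.1 s.2).2 t)) = _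
  cases hb : (X.side s.1 s.2).2 <;> simp [orientParam]

theorem sidePoint_inj {s s' : X.Side} {t t' : I} (ht : t ∈ Set.Ioo (0 : I) 1)
    (ht' : t' ∈ Set.Ioo (0 : I) 1) (h : X.sidePoint s t = X.sidePoint s' t') : s = s' := by
  classical
  have hor : ∀ (b : Bool) {t : I}, t ∈ Set.Ioo (0 : I) 1 →
      orientParam b t ≠ 0 ∧ orientParam b t ≠ 1 := by
    rintro b t ⟨h0, h1⟩
    cases b
    · exact ⟨by simpa [orientParam] using h1.ne, by simpa [orientParam] using h0.ne'⟩
    · exact ⟨by simpa [orientParam] using h0.ne', by simpa [orientParam] using h1.ne⟩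
  let g : X.circles.Realization → Option X.Side :=
    Quot.lift
      (Sum.elim (fun _ => none) fun st => if st.2 = 0 ∨ st.2 = 1 then none else some st.1)
      (by rintro _ _ (s | s) <;> simp)
  have hg : ∀ (s : X.Side) {t : I}, t ∈ Set.Ioo (0 : I) 1 →
      g (X.sidePoint s t) = some s := fun s t ht => by
    have := hor (X.side s.1 s.2).2 ht
    exact if_neg (by tauto)
  have := congrArg g h
  rw [hg s ht, hg s' ht'] at this
  exact Option.some.inj this

/-! ### Stackings -/

/-- A stacking of `X`: a (continuous) injection `Ψ : W → X¹ × ℝ` with `Φ = ρ ∘ Ψ`, where `ρ` is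
the projection to `X¹`. -/
structure Stacking where
  toFun : X.circles.Realization → X.toOneComplex.Realization × ℝ
  continuous_toFun : Continuous toFun
  injective_toFun : Function.Injective toFun
  fst_toFun : ∀ p, (toFun p).1 = X.attach p

namespace Stacking

variable {X} (Ψ : X.Stacking)

/-- The real coordinate of a stacking. -/
def height (p : X.circles.Realization) : ℝ := (Ψ.toFun p).2

/-- A stacking is good if each boundary circle has a point that is lowest, and a point that is
highest, among all points of `W` with the same image in `X¹`. -/
def IsGood : Prop :=
  ∀ r : F,
    (∃ l ∈ X.circle r, IsLeast (Ψ.height '' (X.attach ⁻¹' {X.attach l})) (Ψ.height l)) ∧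
    (∃ h ∈ X.circle r, IsGreatest (Ψ.height '' (X.attach ⁻¹' {X.attach h})) (Ψ.height h))

/-- The side `s` is lower than the side `s'`: they lie over the same 1-cell, and `s` is below `s'`
over each interior point of that 1-cell. -/
def Lower (s s' : X.Side) : Prop :=
  X.under s = X.under s' ∧
    ∀ t ∈ Set.Ioo (0 : I) 1, Ψ.height (X.sidePoint s t) < Ψ.height (X.sidePoint s' t)

/-- Any two distinct sides over a common 1-cell are comparable, so that every dual edge gets a
direction: the heights are continuous and differ over each interior point of the 1-cell. -/
theorem lower_or_lower {s s' : X.Side} (hne : s ≠ s') (he : X.under s = X.under s') :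
    Ψ.Lower s s' ∨ Ψ.Lower s' s := by
  have hcont : ∀ s, Continuous fun t => Ψ.height (X.sidePoint s t) := fun s => by
    have h1 : Continuous (X.circles.edgePoint s) :=
      continuous_iSup_rng (i := s) continuous_coinduced_rng
    have h2 : Continuous (orientParam (X.side s.1 s.2).2) := by
      cases (X.side s.1 s.2).2
      · exact unitInterval.continuous_symm
      · exact continuous_id
    exact continuous_snd.comp (Ψ.continuous_toFun.comp (h1.comp h2))
  have hdiff : ∀ t ∈ Set.Ioo (0 : I) 1,
      Ψ.height (X.sidePoint s t) ≠ Ψ.height (X.sidePoint s' t) := fun t ht heq => by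
    have hp : X.sidePoint s t = X.sidePoint s' t := by
      apply Ψ.injective_toFun
      refine Prod.ext ?_ heq
      rw [Ψ.fst_toFun, Ψ.fst_toFun, attach_sidePoint, attach_sidePoint, he]
    exact hne (X.sidePoint_inj ht ht hp)
  by_contra hcon
  simp only [Lower, he, true_and, not_or, not_forall, not_lt] at hcon
  obtain ⟨⟨t, ht, h1⟩, ⟨t', ht', h2⟩⟩ := hcon
  obtain ⟨c, hc, hc'⟩ := Set.ordConnected_Ioo.isPreconnected.intermediate_value₂ ht' ht
    (hcont s).continuousOn (hcont s').continuousOn h2 h1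
  exact hdiff c hc hc'

/-- The dual graph directed by the stacking. Its vertices are the 2-cells. There is a dual edge
for each two distinct sides over a common 1-cell, joining the 2-cells they belong to, and it is
directed from the 2-cell of the lower side to the 2-cell of the higher side. -/
def directedDual : Digraph F where
  Adj r r' := ∃ (i : ZMod (X.len r)) (j : ZMod (X.len r')), Ψ.Lower ⟨r, i⟩ ⟨r', j⟩

end Stacking

end TwoComplex

/-- A digraph is acyclic if it has no directed cycle, i.e. no vertex can be reached from itself
along one or more directed edges. -/
def Digraph.IsAcyclic {F : Type w} (Γ : Digraph F) : Prop :=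
  ∀ r : F, ¬ Relation.TransGen Γ.Adj r r

/-! A directed cycle of the dual graph is lifted to a complex over `X` with finitely many 2-cells
and no first cohomology mod 2 (a `Development`), and the dual graph of such a complex is shown to be
acyclic. The cohomological condition replaces simple connectivity: it survives attaching, folding
and collapsing, and it bounds the Euler characteristic.

Lifting (`exists_cycle`): a chain of 2-cells is built one at a time, together with an edge path
joining its two ends. The label of that path is closed, hence null-homotopic in `X`, and each
elementary move of the homotopy can be imitated by attaching cells and folding. Once the path is
empty, the two end cells share a corner and fold together.

Acyclicity (`not_transGen_polygonAdj`), by induction on the number of 2-cells: distinct cells with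
the same label and a common corner are folded. Otherwise, if every 2-cell had a side that is not
topmost over its 1-cell, counting topmost sides and corners would give V + F ≤ E for the cells
covered by the 2-cells (`card_le`), against E < V + F from cohomology (`card_sideEdge_lt`). So some
2-cell is topmost along all its sides. It has no outgoing dual edge, and its lowest side is alone
over its 1-cell; the cell collapses and every directed cycle survives. -/

namespace TwoComplex

/-! ### From a good stacking to an order on sides -/

variable {V : Type u} {E : Type v} {F : Type w} (X : TwoComplex V E F)

/-- The corner of a side that lies over the source of its 1-cell. -/
def sourceCorner (s : X.Side) : X.Side := if (X.side s.1 s.2).2 then s else ⟨s.1, s.2 + 1⟩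

/-- The corner of a side that lies over the target of its 1-cell. -/
def targetCorner (s : X.Side) : X.Side := if (X.side s.1 s.2).2 then ⟨s.1, s.2 + 1⟩ else s

/-- The combinatorial content of a good stacking: an order on the sides over each 1-cell, induced
by heights of the corners at either end, in which each 2-cell has a highest and a lowest side. -/
structure SideOrder where
  lower : X.Side → X.Side → Prop
  height : X.Side → ℝ
  under_eq : ∀ {s s'}, lower s s' → X.under s = X.under s'
  total : ∀ {s s'}, s ≠ s' → X.under s = X.under s' → lower s s' ∨ lower s' s
  height_source : ∀ {s s'}, lower s s' → height (X.sourceCorner s) < height (X.sourceCorner s')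
  height_target : ∀ {s s'}, lower s s' → height (X.targetCorner s) < height (X.targetCorner s')
  exists_highest : ∀ r, ∃ i, ∀ s, ¬ lower ⟨r, i⟩ s
  exists_lowest : ∀ r, ∃ i, ∀ s, ¬ lower s ⟨r, i⟩

theorem circles_edgePoint_zero (s : X.Side) :
    X.circles.edgePoint s 0 = X.circles.vertexPoint s :=
  Quot.sound (OneComplex.Glue.atSrc (G := X.circles) s)

theorem circles_edgePoint_one (s : X.Side) :
    X.circles.edgePoint s 1 = X.circles.vertexPoint ⟨s.1, s.2 + 1⟩ :=
  Quot.sound (OneComplex.Glue.atTgt (G := X.circles) s)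

theorem sidePoint_zero (s : X.Side) :
    X.sidePoint s 0 = X.circles.vertexPoint (X.sourceCorner s) := by
  unfold sidePoint sourceCorner
  cases (X.side s.1 s.2).2
  · simpa [orientParam] using X.circles_edgePoint_one s
  · simpa [orientParam] using X.circles_edgePoint_zero s

theorem sidePoint_one (s : X.Side) :
    X.sidePoint s 1 = X.circles.vertexPoint (X.targetCorner s) := by
  unfold sidePoint targetCorner
  cases (X.side s.1 s.2).2
  · simpa [orientParam] using X.circles_edgePoint_zero s
  · simpa [orientParam] using X.circles_edgePoint_one s

theorem circles_vertexPoint_injective : Function.Injective X.circles.vertexPoint := by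
  classical
  intro s s' h
  let g : X.circles.Realization → Option X.Side :=
    Quot.lift
      (Sum.elim some fun st => if st.2 = 0 then some st.1 else
        if st.2 = 1 then some ⟨st.1.1, st.1.2 + 1⟩ else none)
      (by rintro _ _ (s | s) <;> simp [circles])
  exact Option.some.inj (congrArg g h)

theorem succ_injective {s s' : X.Side}
    (h : (⟨s.1, s.2 + 1⟩ : X.Side) = ⟨s'.1, s'.2 + 1⟩) : s = s' := by
  obtain ⟨r, i⟩ := s
  obtain ⟨r', i'⟩ := s'
  obtain ⟨rfl, h⟩ := Sigma.mk.inj h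
  simpa using h

/-- Consecutive sides over one 1-cell in opposite directions would form a backtrack. This is where
immersion enters: it keeps distinct sides over a 1-cell from sharing a corner over the same end. -/
theorem no_backtrack {s s' : X.Side} (hu : X.under s = X.under s')
    (h : s = ⟨s'.1, s'.2 + 1⟩) : (X.side s.1 s.2).2 = (X.side s'.1 s'.2).2 := by
  subst h
  by_contra hb
  refine X.immersed s'.1 s'.2 (Prod.ext hu ?_)
  simpa using Bool.eq_not_of_ne hb

theorem sourceCorner_inj {s s' : X.Side} (hu : X.under s = X.under s')
    (h : X.sourceCorner s = X.sourceCorner s') : s = s' := by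
  have h1 := X.no_backtrack hu
  have h2 := X.no_backtrack hu.symm
  unfold sourceCorner at h
  split_ifs at h with hb hb' hb'
  · exact h
  · have := h1 h; simp_all
  · have := h2 h.symm; simp_all
  · exact X.succ_injective h

theorem targetCorner_inj {s s' : X.Side} (hu : X.under s = X.under s')
    (h : X.targetCorner s = X.targetCorner s') : s = s' := by
  have h1 := X.no_backtrack hu
  have h2 := X.no_backtrack hu.symm
  unfold targetCorner at h
  split_ifs at h with hb hb' hb'
  · exact X.succ_injective h
  · have := h2 h.symm; simp_all
  · have := h1 h; simp_all
  · exact h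

theorem sidePoint_inj' {s s' : X.Side} (hu : X.under s = X.under s') (t : I)
    (h : X.sidePoint s t = X.sidePoint s' t) : s = s' := by
  rcases eq_or_ne t 0 with rfl | h0
  · rw [sidePoint_zero, sidePoint_zero] at h
    exact X.sourceCorner_inj hu (X.circles_vertexPoint_injective h)
  rcases eq_or_ne t 1 with rfl | h1
  · rw [sidePoint_one, sidePoint_one] at h
    exact X.targetCorner_inj hu (X.circles_vertexPoint_injective h)
  have ht : t ∈ Set.Ioo (0 : I) 1 :=
    ⟨unitInterval.pos_iff_ne_zero.2 h0, unitInterval.lt_one_iff_ne_one.2 h1⟩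
  exact X.sidePoint_inj ht ht h

namespace Stacking

variable {X} (Ψ : X.Stacking)

theorem continuous_height_sidePoint (s : X.Side) :
    Continuous fun t => Ψ.height (X.sidePoint s t) := by
  have h1 : Continuous (X.circles.edgePoint s) :=
    continuous_iSup_rng (i := s) continuous_coinduced_rng
  have h2 : Continuous (orientParam (X.side s.1 s.2).2) := by
    cases (X.side s.1 s.2).2
    · exact unitInterval.continuous_symm
    · exact continuous_id
  exact continuous_snd.comp (Ψ.continuous_toFun.comp (h1.comp h2))

theorem eq_of_height_eq {p q : X.circles.Realization} (h : X.attach p = X.attach q)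
    (hh : Ψ.height p = Ψ.height q) : p = q :=
  Ψ.injective_toFun (Prod.ext (by rw [Ψ.fst_toFun, Ψ.fst_toFun, h]) hh)

/-- The strict inequality over the interior extends to the ends, weakly by continuity and then
strictly because distinct sides over a 1-cell do not meet even there. The corners thus inherit the
order. -/
theorem Lower.height_lt {s s' : X.Side} (h : Ψ.Lower s s') (t : I) :
    Ψ.height (X.sidePoint s t) < Ψ.height (X.sidePoint s' t) := by
  have hmid : (⟨1 / 2, by norm_num, by norm_num⟩ : I) ∈ Set.Ioo (0 : I) 1 := by
    constructor <;> rw [← Subtype.coe_lt_coe] <;> norm_num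
  have hne : s ≠ s' := by
    rintro rfl
    exact lt_irrefl _ (h.2 _ hmid)
  refine lt_of_le_of_ne ?_ fun heq => hne (X.sidePoint_inj' h.1 t (Ψ.eq_of_height_eq ?_ heq))
  · have hcl : closure (Set.Ioo (0 : I) 1) = Set.Icc 0 1 := closure_Ioo zero_ne_one
    have ht : t ∈ closure (Set.Ioo (0 : I) 1) := by
      rw [hcl]; exact ⟨unitInterval.nonneg', unitInterval.le_one'⟩
    exact closure_minimal (fun x hx => (h.2 x hx).le)
      (isClosed_le (Ψ.continuous_height_sidePoint s) (Ψ.continuous_height_sidePoint s')) ht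
  · rw [attach_sidePoint, attach_sidePoint, h.1]

theorem exists_eq_sidePoint {r : F} {p : X.circles.Realization} (hp : p ∈ X.circle r) :
    ∃ i t, p = X.sidePoint ⟨r, i⟩ t := by
  obtain ⟨i, t, rfl⟩ := hp
  refine ⟨i, orientParam (X.side r i).2 t, ?_⟩
  unfold sidePoint
  cases (X.side r i).2 <;> simp [orientParam]

/-- The order on the sides of the 2-cells given by a good stacking. -/
def sideOrder (hΨ : Ψ.IsGood) : X.SideOrder where
  lower := Ψ.Lower
  height s := Ψ.height (X.circles.vertexPoint s)
  under_eq h := h.1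
  total := Ψ.lower_or_lower
  height_source h := by
    simpa only [sidePoint_zero] using Lower.height_lt Ψ h 0
  height_target h := by
    simpa only [sidePoint_one] using Lower.height_lt Ψ h 1
  exists_highest r := by
    obtain ⟨-, p, hp, hmax⟩ := hΨ r
    obtain ⟨i, t, rfl⟩ := exists_eq_sidePoint hp
    refine ⟨i, fun s hs => (Lower.height_lt Ψ hs t).not_ge (hmax.2 ⟨_, ?_, rfl⟩)⟩
    simp [attach_sidePoint, hs.1]
  exists_lowest r := by
    obtain ⟨⟨p, hp, hmin⟩, -⟩ := hΨ r
    obtain ⟨i, t, rfl⟩ := exists_eq_sidePoint hp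
    refine ⟨i, fun s hs => (Lower.height_lt Ψ hs t).not_ge (hmin.2 ⟨_, ?_, rfl⟩)⟩
    simp [attach_sidePoint, hs.1]

end Stacking

end TwoComplex

/-! ### Edge paths and mod 2 coboundaries -/

namespace OneComplex

variable {V : Type u} {E : Type v} (G : OneComplex V E)

theorem isPath_cons_iff {x y : V} {d : E × Bool} {p : List (E × Bool)} :
    G.IsPath x (d :: p) y ↔ G.start d = x ∧ G.IsPath (G.finish d) p y := by
  constructor
  · intro h
    cases h with
    | cons d p y h => exact ⟨rfl, h⟩
  · rintro ⟨rfl, h⟩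
    exact .cons d p y h

theorem isPath_nil_iff {x y : V} : G.IsPath x [] y ↔ x = y := by
  constructor
  · intro h
    cases h
    rfl
  · rintro rfl
    exact .nil x

theorem isPath_append_iff {x y : V} {p q : List (E × Bool)} :
    G.IsPath x (p ++ q) y ↔ ∃ z, G.IsPath x p z ∧ G.IsPath z q y := by
  induction p generalizing x with
  | nil => simp [isPath_nil_iff]
  | cons d p ih => simp [isPath_cons_iff, ih, and_assoc]

theorem IsPath.end_unique {x y z : V} {p : List (E × Bool)} (h : G.IsPath x p y)
    (h' : G.IsPath x p z) : y = z := by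
  induction p generalizing x with
  | nil => exact ((G.isPath_nil_iff.1 h).symm.trans (G.isPath_nil_iff.1 h'))
  | cons d p ih => exact ih (G.isPath_cons_iff.1 h).2 (G.isPath_cons_iff.1 h').2

end OneComplex

/-- The 1-cell `(a, e, b)` from `a` to `b` with label `e`, where the oriented label `d = (e, _)` is
read from `a` to `b`. -/
def orientedEdge {E : Type v} {S : Type*} (a : S) (d : E × Bool) (b : S) : S × E × S :=
  if d.2 then (a, d.1, b) else (b, d.1, a)

/-- The map induced on labelled 1-cells by a map of 0-cells. -/
def mapEdge {E : Type v} {S T : Type*} (π : S → T) (x : S × E × S) : T × E × T :=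
  (π x.1, x.2.1, π x.2.2)

theorem mapEdge_orientedEdge {E : Type v} {S T : Type*} (π : S → T) (a : S) (d : E × Bool)
    (b : S) : mapEdge π (orientedEdge a d b) = orientedEdge (π a) d (π b) := by
  unfold orientedEdge mapEdge
  split_ifs <;> rfl

/-- The coboundary of a 0-cochain modulo 2. -/
def coboundary {E : Type v} {S : Type*} (g : S → ZMod 2) (x : S × E × S) : ZMod 2 :=
  g x.2.2 - g x.1

theorem coboundary_orientedEdge {E : Type v} {S : Type*} (g : S → ZMod 2) (a : S) (d : E × Bool)
    (b : S) : coboundary g (orientedEdge a d b) = g b - g a := by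
  unfold orientedEdge coboundary
  split_ifs
  · rfl
  · simp only [CharTwo.sub_eq_add, add_comm]

/-! ### Developments and the operations that keep the first cohomology zero -/

namespace TwoComplex

variable {V : Type u} {E : Type v} {F : Type w} (X : TwoComplex V E F)

instance (r : F) : NeZero (X.len r) := ⟨(X.len_pos r).ne'⟩

/-- A 2-cell with label in `X` and corners in `S`. -/
abbrev Polygon (S : Type*) := Σ r : F, ZMod (X.len r) → S

variable {X}

namespace Polygon

variable {S T : Type*}

/-- The 1-cell traversed by a side of a polygon. -/
def edge (R : X.Polygon S) (j : ZMod (X.len R.1)) : S × E × S :=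
  orientedEdge (R.2 j) (X.side R.1 j) (R.2 (j + 1))

/-- The image of a polygon under a map of 0-cells. -/
def map (π : S → T) (R : X.Polygon S) : X.Polygon T := ⟨R.1, π ∘ R.2⟩

theorem edge_map (π : S → T) (R : X.Polygon S) (j : ZMod (X.len R.1)) :
    (R.map π).edge j = mapEdge π (R.edge j) :=
  (mapEdge_orientedEdge π _ _ _).symm

end Polygon

variable (X) in
/-- A complex over `X` with finitely many 2-cells and no first cohomology modulo 2. Its 1-cells and
2-cells are determined by their labels in `X` and their 0-cells. -/
structure Development where
  S : Type
  lab : S → V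
  edges : Set (S × E × S)
  faces : Set (X.Polygon S)
  finite_faces : faces.Finite
  lab_edge : ∀ x ∈ edges, lab x.1 = X.src x.2.1 ∧ lab x.2.2 = X.tgt x.2.1
  face_edge : ∀ R ∈ faces, ∀ j, Polygon.edge R j ∈ edges
  exact : ∀ f : S × E × S → ZMod 2, (∀ R ∈ faces, ∑ j, f (Polygon.edge R j) = 0) →
    ∃ g : S → ZMod 2, ∀ x ∈ edges, f x = coboundary g x

namespace Development

variable (Y : X.Development)

theorem lab_orientedEdge {a b : Y.S} {d : E × Bool} (h : orientedEdge a d b ∈ Y.edges) :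
    Y.lab a = X.toOneComplex.start d ∧ Y.lab b = X.toOneComplex.finish d := by
  have := Y.lab_edge _ h
  obtain ⟨e, _ | _⟩ := d <;>
    simp_all [orientedEdge, OneComplex.start, OneComplex.finish]

theorem lab_corner {R : X.Polygon Y.S} (hR : R ∈ Y.faces) (j : ZMod (X.len R.1)) :
    Y.lab (R.2 j) = X.toOneComplex.start (X.side R.1 j) :=
  (Y.lab_orientedEdge (Y.face_edge R hR j)).1

/-- The edge paths of a development, with labels in `X`. -/
inductive Walk : Y.S → List (E × Bool) → Y.S → Prop
  | nil (a : Y.S) : Walk a [] a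
  | cons (a b c : Y.S) (d : E × Bool) (p : List (E × Bool)) (h : orientedEdge a d b ∈ Y.edges)
      (hp : Walk b p c) : Walk a (d :: p) c

variable {Y}

theorem walk_nil_iff {a c : Y.S} : Y.Walk a [] c ↔ a = c := by
  constructor
  · intro h
    cases h
    rfl
  · rintro rfl
    exact .nil a

theorem walk_cons_iff {a c : Y.S} {d : E × Bool} {p : List (E × Bool)} :
    Y.Walk a (d :: p) c ↔ ∃ b, orientedEdge a d b ∈ Y.edges ∧ Y.Walk b p c := by
  constructor
  · intro h
    cases h with
    | cons a b c d p h hp => exact ⟨b, h, hp⟩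
  · rintro ⟨b, h, hp⟩
    exact .cons a b c d p h hp

theorem walk_append_iff {a c : Y.S} {p q : List (E × Bool)} :
    Y.Walk a (p ++ q) c ↔ ∃ b, Y.Walk a p b ∧ Y.Walk b q c := by
  induction p generalizing a with
  | nil => simp [walk_nil_iff]
  | cons d p ih =>
    simp only [List.cons_append, walk_cons_iff, ih]
    constructor
    · rintro ⟨b, h, b', h1, h2⟩
      exact ⟨b', ⟨b, h, h1⟩, h2⟩
    · rintro ⟨b', ⟨b, h, h1⟩, h2⟩
      exact ⟨b, h, b', h1, h2⟩

theorem Walk.isPath {a c : Y.S} {p : List (E × Bool)} (h : Y.Walk a p c) :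
    X.toOneComplex.IsPath (Y.lab a) p (Y.lab c) := by
  induction h with
  | nil a => exact .nil _
  | cons a b c d p h hp ih =>
    obtain ⟨h1, h2⟩ := Y.lab_orientedEdge h
    rw [OneComplex.isPath_cons_iff]
    exact ⟨h1.symm, h2 ▸ ih⟩

/-- The successive 0-cells of an edge path. -/
theorem Walk.exists_positions {a c : Y.S} {p : List (E × Bool)} (h : Y.Walk a p c) :
    ∃ pos : ℕ → Y.S, pos 0 = a ∧ pos p.length = c ∧
      ∀ k (hk : k < p.length), orientedEdge (pos k) p[k] (pos (k + 1)) ∈ Y.edges := by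
  induction h with
  | nil a => exact ⟨fun _ => a, rfl, rfl, by simp⟩
  | cons a b c d p h hp ih =>
    obtain ⟨pos, h0, h1, h2⟩ := ih
    refine ⟨fun k => k.casesOn a pos, rfl, h1, ?_⟩
    rintro (_ | k) hk
    · simpa [h0] using h
    · simpa using h2 k (by simpa using hk)

/-- A map of 0-cells that carries 1-cells to 1-cells and 2-cells to 2-cells. -/
structure IsHom {Y Y' : X.Development} (π : Y.S → Y'.S) : Prop where
  lab : ∀ a, Y'.lab (π a) = Y.lab a
  edge : ∀ x ∈ Y.edges, mapEdge π x ∈ Y'.edges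
  face : ∀ R ∈ Y.faces, R.map π ∈ Y'.faces

theorem IsHom.comp {Y Y' Y'' : X.Development} {π' : Y'.S → Y''.S} {π : Y.S → Y'.S}
    (h' : IsHom π') (h : IsHom π) : IsHom (π' ∘ π) where
  lab a := (h'.lab _).trans (h.lab a)
  edge x hx := h'.edge _ (h.edge x hx)
  face R hR := h'.face _ (h.face R hR)

theorem IsHom.id : IsHom (_root_.id : Y.S → Y.S) where
  lab _ := rfl
  edge _ hx := hx
  face _ hR := hR

theorem IsHom.walk {Y' : X.Development} {π : Y.S → Y'.S} (hπ : IsHom π) {a c : Y.S}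
    {p : List (E × Bool)} (h : Y.Walk a p c) : Y'.Walk (π a) p (π c) := by
  induction h with
  | nil a => exact .nil _
  | cons a b c d p h hp ih =>
    exact .cons _ _ _ _ _ (mapEdge_orientedEdge π a d b ▸ hπ.edge _ h) ih

theorem zmod_induction {n : ℕ} [NeZero n] {P : ZMod n → Prop} (i : ZMod n) (h : P i)
    (hs : ∀ j, P j → P (j + 1)) (j : ZMod n) : P j := by
  have key : ∀ k : ℕ, P (i + k) := by
    intro k
    induction k with
    | zero => simpa using h
    | succ k ih => simpa [add_assoc] using hs _ ih
  simpa using key (j - i).val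

theorem exists_walk_corners {R : X.Polygon Y.S} (hR : R ∈ Y.faces) (i j : ZMod (X.len R.1)) :
    ∃ p, Y.Walk (R.2 i) p (R.2 j) := by
  refine zmod_induction (P := fun j => ∃ p, Y.Walk (R.2 i) p (R.2 j)) i ⟨[], .nil _⟩ ?_ j
  rintro j ⟨p, hp⟩
  exact ⟨p ++ [X.side R.1 j], walk_append_iff.2 ⟨_, hp, .cons _ _ _ _ _ (Y.face_edge R hR j)
    (.nil _)⟩⟩

/-- The new 1-cell ends at a new 0-cell, where the potential of a cocycle can be chosen freely. -/
theorem exists_isHom_edge (Y : X.Development) (a : Y.S) (d : E × Bool)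
    (h : Y.lab a = X.toOneComplex.start d) : ∃ (Y' : X.Development) (π : Y.S → Y'.S),
      IsHom π ∧ ∃ b, orientedEdge (π a) d b ∈ Y'.edges := by
  refine ⟨{ S := Option Y.S
            lab := fun b => b.elim (X.toOneComplex.finish d) Y.lab
            edges := insert (orientedEdge (some a) d none) (mapEdge some '' Y.edges)
            faces := Polygon.map some '' Y.faces
            finite_faces := Y.finite_faces.image _
            lab_edge := ?_
            face_edge := ?_
            exact := ?_ }, some,
          ⟨fun _ => rfl, fun x hx => .inr ⟨x, hx, rfl⟩, fun R hR => ⟨R, hR, rfl⟩⟩, none, .inl rfl⟩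
  · rintro _ (rfl | ⟨x, hx, rfl⟩)
    · obtain ⟨e, _ | _⟩ := d <;>
        simp_all [orientedEdge, OneComplex.start, OneComplex.finish]
    · exact Y.lab_edge x hx
  · rintro _ ⟨R, hR, rfl⟩ j
    exact .inr ⟨_, Y.face_edge R hR j, (Polygon.edge_map _ _ _).symm⟩
  · intro f hf
    obtain ⟨g, hg⟩ := Y.exact (f ∘ mapEdge some) fun R hR =>
      (Finset.sum_congr rfl fun j _ => congrArg f (Polygon.edge_map some R j).symm).trans
        (hf _ ⟨R, hR, rfl⟩)
    refine ⟨fun b => b.elim (g a + f (orientedEdge (some a) d none)) g, ?_⟩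
    rintro _ (rfl | ⟨x, hx, rfl⟩)
    · rw [coboundary_orientedEdge]
      simp
    · exact hg x hx

theorem exists_isHom_walk (Y : X.Development) (a : Y.S) (p : List (E × Bool)) (y : V)
    (h : X.toOneComplex.IsPath (Y.lab a) p y) : ∃ (Y' : X.Development) (π : Y.S → Y'.S),
      IsHom π ∧ ∃ b, Y'.Walk (π a) p b := by
  induction p generalizing Y with
  | nil => exact ⟨Y, id, .id, a, .nil a⟩
  | cons d p ih =>
    obtain ⟨h1, h2⟩ := (OneComplex.isPath_cons_iff _).1 h
    obtain ⟨Y₁, π₁, hπ₁, b, hb⟩ := Y.exists_isHom_edge a d h1.symm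
    obtain ⟨Y₂, π₂, hπ₂, c, hc⟩ := ih Y₁ b ((Y₁.lab_orientedEdge hb).2 ▸ h2)
    refine ⟨Y₂, π₂ ∘ π₁, hπ₂.comp hπ₁, c, .cons _ (π₂ b) _ _ _ ?_ hc⟩
    exact mapEdge_orientedEdge π₂ _ _ _ ▸ hπ₂.edge _ hb

/-- The quotient of a development by an identification of 0-cells which is respected by the
potential of each cocycle, with additional 2-cells attached. -/
def quotient (Y : X.Development) (ρ : Y.S → Y.S → Prop) (hρ : ∀ a b, ρ a b → Y.lab a = Y.lab b)
    (extra : Set (X.Polygon (Quot ρ))) (hfin : extra.Finite)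
    (hedge : ∀ R ∈ extra, ∀ j, Polygon.edge R j ∈ mapEdge (Quot.mk ρ) '' Y.edges)
    (hexact : ∀ (f : Quot ρ × E × Quot ρ → ZMod 2) (g : Y.S → ZMod 2),
      (∀ R ∈ extra, ∑ j, f (Polygon.edge R j) = 0) →
      (∀ x ∈ Y.edges, f (mapEdge (Quot.mk ρ) x) = coboundary g x) → ∀ a b, ρ a b → g a = g b) :
    X.Development where
  S := Quot ρ
  lab := Quot.lift Y.lab hρ
  edges := mapEdge (Quot.mk ρ) '' Y.edges
  faces := Polygon.map (Quot.mk ρ) '' Y.faces ∪ extra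
  finite_faces := (Y.finite_faces.image _).union hfin
  lab_edge := by
    rintro _ ⟨x, hx, rfl⟩
    exact Y.lab_edge x hx
  face_edge := by
    rintro R (⟨R, hR, rfl⟩ | hR) j
    · exact ⟨_, Y.face_edge R hR j, (Polygon.edge_map _ _ _).symm⟩
    · exact hedge R hR j
  exact := by
    intro f hf
    obtain ⟨g, hg⟩ := Y.exact (f ∘ mapEdge (Quot.mk ρ)) fun R hR =>
      (Finset.sum_congr rfl fun j _ => congrArg f (Polygon.edge_map (Quot.mk ρ) R j).symm).trans
        (hf _ (.inl ⟨R, hR, rfl⟩))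
    refine ⟨Quot.lift g (hexact f g (fun R hR => hf R (.inr hR)) hg), ?_⟩
    rintro _ ⟨x, hx, rfl⟩
    exact hg x hx

theorem isHom_quotient (Y : X.Development) (ρ : Y.S → Y.S → Prop) (hρ) (extra) (hfin) (hedge)
    (hexact) : IsHom (Y := Y) (Y' := Y.quotient ρ hρ extra hfin hedge hexact) (Quot.mk ρ) where
  lab _ := rfl
  edge x hx := ⟨x, hx, rfl⟩
  face R hR := .inl ⟨R, hR, rfl⟩

/-- Identifying the far ends makes the two 1-cells equal, so a cocycle of the quotient has one value
on both and its potential agrees at the identified 0-cells. -/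
theorem exists_isHom_backtrack (Y : X.Development) {a b : Y.S} {e : E} {o : Bool}
    (h : Y.Walk a [(e, o), (e, !o)] b) : ∃ (Y' : X.Development) (π : Y.S → Y'.S),
      IsHom π ∧ π a = π b := by
  obtain ⟨c, hc, h⟩ := walk_cons_iff.1 h
  obtain ⟨b', hb', h⟩ := walk_cons_iff.1 h
  obtain rfl := walk_nil_iff.1 h
  refine ⟨_, _, Y.isHom_quotient (fun x y => x = a ∧ y = b') ?_ ∅ Set.finite_empty (by simp) ?_,
    Quot.sound ⟨rfl, rfl⟩⟩
  · rintro _ _ ⟨rfl, rfl⟩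
    rw [(Y.lab_orientedEdge hc).1, (Y.lab_orientedEdge hb').2]
    cases o <;> rfl
  · rintro f g - hfg x y ⟨hx, hy⟩
    rw [hx, hy]
    have h1 := hfg _ hc
    have h2 := hfg _ hb'
    rw [coboundary_orientedEdge, mapEdge_orientedEdge] at h1 h2
    have hab : Quot.mk (fun x y => x = a ∧ y = b') a = Quot.mk _ b' := Quot.sound ⟨rfl, rfl⟩
    -- A 1-cell does not remember the direction of traversal.
    have h3 : ∀ t : Quot (fun x y => x = a ∧ y = b'),
        orientedEdge (E := E) t (e, o) (Quot.mk _ c) = orientedEdge (Quot.mk _ c) (e, !o) t := by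
      intro t
      cases o <;> rfl
    rw [hab, h3, h2] at h1
    simp only [CharTwo.sub_eq_add] at h1
    rw [add_comm] at h1
    exact (add_left_cancel h1).symm

theorem sum_zmod_eq_sum_range {n : ℕ} [NeZero n] (i : ZMod n) (f : ZMod n → ZMod 2) :
    ∑ j, f j = ∑ k ∈ Finset.range n, f (i + k) := by
  symm
  refine Finset.sum_bij (fun k _ => i + k) (by simp) ?_ ?_ (by simp)
  · intro k hk l hl h
    have := congrArg ZMod.val (add_left_cancel h)
    rwa [ZMod.val_cast_of_lt (Finset.mem_range.1 hk), ZMod.val_cast_of_lt (Finset.mem_range.1 hl)]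
      at this
  · intro j _
    exact ⟨(j - i).val, by simpa using ZMod.val_lt _, by simp⟩

theorem val_sub_add_one {n : ℕ} [NeZero n] {T : Type*} (pos : ℕ → T) (h : pos 0 = pos n)
    (m : ZMod n) : pos (m + 1).val = pos (m.val + 1) := by
  rcases (Nat.succ_le_of_lt (ZMod.val_lt m)).lt_or_eq with hlt | heq
  · have : m + 1 = ((m.val + 1 : ℕ) : ZMod n) := by simp
    rw [this, ZMod.val_cast_of_lt hlt]
  · have : m + 1 = ((m.val + 1 : ℕ) : ZMod n) := by simp
    rw [this, ← Nat.succ_eq_add_one, heq, ZMod.natCast_self, ZMod.val_zero, h]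

/-- Joining the ends of the walk may create a loop, which the new 2-cell kills: a cocycle sums to
zero around it, so by telescoping its potential agrees at the two ends. -/
theorem exists_isHom_cell (Y : X.Development) {a b : Y.S} {r : F} {i : ZMod (X.len r)}
    (h : Y.Walk a (X.boundaryPath r i) b) : ∃ (Y' : X.Development) (π : Y.S → Y'.S),
      IsHom π ∧ π a = π b ∧ ∃ c, (⟨r, c⟩ : X.Polygon Y'.S) ∈ Y'.faces ∧ c i = π a := by
  obtain ⟨pos, rfl, rfl, hpos⟩ := h.exists_positions
  have hlen : (X.boundaryPath r i).length = X.len r := by simp [boundaryPath]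
  have hpos' : ∀ k, k < X.len r →
      orientedEdge (pos k) (X.side r (i + k)) (pos (k + 1)) ∈ Y.edges := by
    intro k hk
    simpa [boundaryPath] using hpos k (hlen ▸ hk)
  let ρ : Y.S → Y.S → Prop := fun x y => x = pos 0 ∧ y = pos (X.len r)
  have h0 : Quot.mk ρ (pos 0) = Quot.mk ρ (pos (X.len r)) := Quot.sound ⟨rfl, rfl⟩
  let R : X.Polygon (Quot ρ) := ⟨r, fun j => Quot.mk ρ (pos (j - i).val)⟩
  have hR : ∀ j, R.edge j = mapEdge (Quot.mk ρ) (orientedEdge (pos (j - i).val)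
      (X.side r j) (pos ((j - i).val + 1))) := by
    intro j
    rw [mapEdge_orientedEdge]
    unfold Polygon.edge
    congr 1
    have := val_sub_add_one (fun k => Quot.mk ρ (pos k)) h0 (j - i)
    rw [← this]
    simp only [R]
    congr 3
    ring
  have hmem : ∀ j, orientedEdge (pos (j - i).val) (X.side r j) (pos ((j - i).val + 1)) ∈
      Y.edges := by
    intro j
    simpa using hpos' (j - i).val (ZMod.val_lt _)
  rw [hlen]
  refine ⟨_, _, Y.isHom_quotient ρ ?_ {R} (Set.finite_singleton _) ?_ ?_, h0, R.2,
    .inr rfl, ?_⟩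
  · rintro _ _ ⟨rfl, rfl⟩
    have h1 := (Y.lab_orientedEdge (hmem i)).1
    have h2 := (Y.lab_orientedEdge (hmem (i - 1))).2
    rw [X.closed, sub_add_cancel] at h2
    -- The side before corner `i` is the last one of the walk, so its endpoint is position `len r`.
    have h3 : (i - 1 - i : ZMod (X.len r)).val + 1 = X.len r := by
      have hp := X.len_pos r
      have : (i - 1 - i : ZMod (X.len r)) = ((X.len r - 1 : ℕ) : ZMod (X.len r)) := by
        rw [Nat.cast_sub hp]; simp
      rw [this, ZMod.val_cast_of_lt (by omega)]
      omega
    rw [h3] at h2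
    rw [sub_self, ZMod.val_zero] at h1
    rw [h1, h2]
  · rintro _ rfl j
    exact ⟨_, hmem j, (hR j).symm⟩
  · rintro f g hf hfg _ _ ⟨rfl, rfl⟩
    have h1 := hf R rfl
    rw [sum_zmod_eq_sum_range i] at h1
    have h2 : ∀ k ∈ Finset.range (X.len r), f (R.edge (i + k)) = g (pos (k + 1)) - g (pos k) := by
      intro k hk
      rw [hR, hfg _ (hmem _), coboundary_orientedEdge, add_sub_cancel_left,
        ZMod.val_cast_of_lt (Finset.mem_range.1 hk)]
    rw [Finset.sum_congr rfl h2, Finset.sum_range_sub (fun k => g (pos k))] at h1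
    exact (sub_eq_zero.1 h1).symm
  · exact congrArg (fun m => Quot.mk ρ (pos m)) (by rw [sub_self, ZMod.val_zero])

/-- Corresponding sides become equal, so a cocycle changes the potential by the same amount along
both boundaries. The potentials agree at the common corner, hence all the way round. The formula for
the faces serves to count them afterwards. -/
theorem exists_isHom_fold (Y : X.Development) {r : F} {c c' : ZMod (X.len r) → Y.S}
    (hc : (⟨r, c⟩ : X.Polygon Y.S) ∈ Y.faces) (hc' : (⟨r, c'⟩ : X.Polygon Y.S) ∈ Y.faces)
    {i : ZMod (X.len r)} (h : c i = c' i) : ∃ (Y' : X.Development) (π : Y.S → Y'.S),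
      IsHom π ∧ π ∘ c = π ∘ c' ∧ Y'.faces = Polygon.map π '' Y.faces := by
  let ρ : Y.S → Y.S → Prop := fun x y => ∃ j, x = c j ∧ y = c' j
  have hcc : Quot.mk ρ ∘ c = Quot.mk ρ ∘ c' := funext fun j => Quot.sound ⟨j, rfl, rfl⟩
  refine ⟨_, _, Y.isHom_quotient ρ ?_ ∅ Set.finite_empty (by simp) ?_, hcc, Set.union_empty _⟩
  · rintro _ _ ⟨j, rfl, rfl⟩
    rw [Y.lab_corner hc, Y.lab_corner hc']
  · rintro f g - hfg _ _ ⟨j, rfl, rfl⟩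
    refine zmod_induction (P := fun j => g (c j) = g (c' j)) i (by rw [h]) ?_ j
    intro j hj
    have h1 := hfg _ (Y.face_edge _ hc j)
    have h2 := hfg _ (Y.face_edge _ hc' j)
    rw [← Polygon.edge_map] at h1 h2
    have h3 : ∀ d d' : ZMod (X.len r) → Quot ρ, d = d' →
        Polygon.edge (X := X) ⟨r, d⟩ j = Polygon.edge (X := X) ⟨r, d'⟩ j := by
      rintro d _ rfl
      rfl
    rw [show (Polygon.map (X := X) (Quot.mk ρ) ⟨r, c⟩).edge j = _ from h3 _ _ hcc] at h1
    have h6 := h1.symm.trans h2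
    unfold Polygon.edge at h6
    rw [coboundary_orientedEdge, coboundary_orientedEdge, hj] at h6
    exact sub_left_injective h6

end Development

end TwoComplex

/-! ### Lifting a directed cycle to a development -/

namespace TwoComplex

variable {V : Type u} {E : Type v} {F : Type w} {X : TwoComplex V E F}

/-- The directed dual graph of a set of polygons, two sides of which are compared when they
traverse the same 1-cell. -/
def SideOrder.polygonAdj (O : X.SideOrder) {S : Type*} (A : Set (X.Polygon S))
    (R R' : X.Polygon S) : Prop :=
  R ∈ A ∧ R' ∈ A ∧ ∃ j j', R.edge j = R'.edge j' ∧ O.lower ⟨R.1, j⟩ ⟨R'.1, j'⟩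

theorem isPath_boundaryPath (r : F) (i : ZMod (X.len r)) :
    ∃ y, X.toOneComplex.IsPath (X.toOneComplex.start (X.side r i)) (X.boundaryPath r i) y := by
  have key : ∀ (n : ℕ) (i : ZMod (X.len r)), ∃ y, X.toOneComplex.IsPath
      (X.toOneComplex.start (X.side r i))
      (List.ofFn fun k : Fin n => X.side r (i + (k : ℕ))) y := by
    intro n
    induction n with
    | zero => exact fun i => ⟨_, .nil _⟩
    | succ n ih =>
      intro i
      obtain ⟨y, hy⟩ := ih (i + 1)
      refine ⟨y, ?_⟩
      rw [List.ofFn_succ, OneComplex.isPath_cons_iff, Fin.val_zero, Nat.cast_zero, add_zero,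
        X.closed]
      refine ⟨rfl, ?_⟩
      have e : (fun k : Fin n => X.side r (i + (k.succ.val : ℕ))) =
          fun k : Fin n => X.side r (i + 1 + (k : ℕ)) := by
        funext k
        rw [Fin.val_succ, Nat.cast_add, Nat.cast_one, add_right_comm, add_assoc i]
      exact e ▸ hy
  exact key _ i

namespace Development

variable {Y Y' : X.Development} (O : X.SideOrder)

theorem IsHom.polygonAdj {π : Y.S → Y'.S} (hπ : IsHom π) {R R' : X.Polygon Y.S}
    (h : O.polygonAdj Y.faces R R') : O.polygonAdj Y'.faces (R.map π) (R'.map π) := by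
  obtain ⟨hR, hR', j, j', he, hl⟩ := h
  refine ⟨hπ.face _ hR, hπ.face _ hR', j, j', ?_, hl⟩
  exact (R.edge_map π j).trans ((congrArg _ he).trans (R'.edge_map π j').symm)

theorem IsHom.transGen {π : Y.S → Y'.S} (hπ : IsHom π) {R R' : X.Polygon Y.S}
    (h : Relation.TransGen (O.polygonAdj Y.faces) R R') :
    Relation.TransGen (O.polygonAdj Y'.faces) (R.map π) (R'.map π) :=
  Relation.TransGen.lift (Polygon.map π) (fun _ _ => hπ.polygonAdj O) _ _ h

theorem right_mem_of_transGen {R R' : X.Polygon Y.S}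
    (h : Relation.TransGen (O.polygonAdj Y.faces) R R') : R' ∈ Y.faces := by
  cases h with
  | single h => exact h.2.1
  | tail _ h => exact h.2.1

theorem left_mem_of_transGen {R R' : X.Polygon Y.S}
    (h : Relation.TransGen (O.polygonAdj Y.faces) R R') : R ∈ Y.faces := by
  obtain ⟨_, h, -⟩ := Relation.TransGen.head'_iff.1 h
  exact h.1

theorem exists_isHom_face (Y : X.Development) (a : Y.S) (r : F) (i : ZMod (X.len r))
    (h : Y.lab a = X.toOneComplex.start (X.side r i)) :
    ∃ (Y' : X.Development) (π : Y.S → Y'.S), IsHom π ∧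
      ∃ c, (⟨r, c⟩ : X.Polygon Y'.S) ∈ Y'.faces ∧ c i = π a := by
  obtain ⟨y, hy⟩ := isPath_boundaryPath r i
  obtain ⟨Y₁, π₁, hπ₁, b, hb⟩ := Y.exists_isHom_walk a _ y (h ▸ hy)
  obtain ⟨Y₂, π₂, hπ₂, -, c, hc, hci⟩ := Y₁.exists_isHom_cell hb
  exact ⟨Y₂, π₂ ∘ π₁, hπ₂.comp hπ₁, c, hc, hci⟩

theorem exists_face (r : F) :
    ∃ (Y : X.Development) (R : X.Polygon Y.S), R ∈ Y.faces ∧ R.1 = r := by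
  let Y₀ : X.Development :=
    { S := Unit
      lab := fun _ => X.toOneComplex.start (X.side r 0)
      edges := ∅
      faces := ∅
      finite_faces := Set.finite_empty
      lab_edge := by simp
      face_edge := by simp
      exact := by simp }
  obtain ⟨Y, -, -, c, hc, -⟩ := Y₀.exists_isHom_face () r 0 rfl
  exact ⟨Y, _, hc, rfl⟩

/-- A 2-cell can be attached along a given 1-cell on the boundary of a 2-cell. -/
theorem exists_isHom_adjacent {R : X.Polygon Y.S} (hR : R ∈ Y.faces) {j : ZMod (X.len R.1)}
    {r : F} {j' : ZMod (X.len r)} (h : O.lower ⟨R.1, j⟩ ⟨r, j'⟩) :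
    ∃ (Y' : X.Development) (π : Y.S → Y'.S), IsHom π ∧
      ∃ R' : X.Polygon Y'.S, R'.1 = r ∧ O.polygonAdj Y'.faces (R.map π) R' ∧
        ∃ p, Y'.Walk (π (R.2 j)) p (R'.2 0) := by
  have hu : (X.side R.1 j).1 = (X.side r j').1 := O.under_eq h
  have hmem := Y.face_edge R hR j
  obtain ⟨a, b, hab⟩ : ∃ a b, R.edge j = (a, (X.side R.1 j).1, b) := by
    unfold Polygon.edge orientedEdge
    split_ifs
    exacts [⟨_, _, rfl⟩, ⟨_, _, rfl⟩]
  obtain ⟨m, hm⟩ : ∃ m, R.2 m = a := by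
    unfold Polygon.edge orientedEdge at hab
    split_ifs at hab
    exacts [⟨_, congrArg Prod.fst hab⟩, ⟨_, congrArg Prod.fst hab⟩]
  have hlab : Y.lab a = X.src (X.side r j').1 := by
    have := (Y.lab_edge _ hmem).1
    rw [hab] at this
    rw [this, hu]
  obtain ⟨Y₁, π₁, hπ₁, c, hc, x, hx⟩ : ∃ (Y' : X.Development) (π : Y.S → Y'.S), IsHom π ∧
      ∃ c, (⟨r, c⟩ : X.Polygon Y'.S) ∈ Y'.faces ∧
        ∃ x, Polygon.edge (X := X) ⟨r, c⟩ j' = (π a, (X.side r j').1, x) := by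
    cases ho : (X.side r j').2 with
    | true =>
      obtain ⟨Y₁, π₁, hπ₁, c, hc, hca⟩ := Y.exists_isHom_face a r j' (by
        simp [hlab, OneComplex.start, ho])
      exact ⟨Y₁, π₁, hπ₁, c, hc, c (j' + 1), by simp [Polygon.edge, orientedEdge, ho, hca]⟩
    | false =>
      obtain ⟨Y₁, π₁, hπ₁, c, hc, hca⟩ := Y.exists_isHom_face a r (j' + 1) (by
        rw [← X.closed]
        simp [hlab, OneComplex.finish, ho])
      exact ⟨Y₁, π₁, hπ₁, c, hc, c j', by simp [Polygon.edge, orientedEdge, ho, hca]⟩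
  -- The new cell is so far hinged only at the source of the shared 1-cell. Going back along the old
  -- copy and out along the new one is a backtrack, and folding it merges the two copies.
  have hw : Y₁.Walk (π₁ b) [((X.side r j').1, false), ((X.side r j').1, !false)] x := by
    refine .cons _ (π₁ a) _ _ _ ?_ (.cons _ _ _ _ _ ?_ (.nil _))
    · have := hπ₁.edge _ hmem
      rw [hab, hu] at this
      exact this
    · have := Y₁.face_edge _ hc j'
      rw [hx] at this
      exact this
  obtain ⟨Y₂, π₂, hπ₂, hbx⟩ := Y₁.exists_isHom_backtrack hw
  refine ⟨Y₂, π₂ ∘ π₁, hπ₂.comp hπ₁, Polygon.map π₂ ⟨r, c⟩, rfl,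
    ⟨(hπ₂.comp hπ₁).face _ hR, hπ₂.face _ hc, j, j', ?_, h⟩, ?_⟩
  · rw [show (R.map (π₂ ∘ π₁)).edge j = _ from R.edge_map _ j,
      show (Polygon.map (X := X) π₂ ⟨r, c⟩).edge j' = _ from Polygon.edge_map π₂ ⟨r, c⟩ j',
      hab, hx, hu]
    simp [mapEdge, hbx]
  · obtain ⟨p, hp⟩ := exists_walk_corners hR j m
    obtain ⟨m', hm'⟩ : ∃ m', c m' = π₁ a := by
      unfold Polygon.edge orientedEdge at hx
      split_ifs at hx
      exacts [⟨_, congrArg Prod.fst hx⟩, ⟨_, congrArg Prod.fst hx⟩]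
    obtain ⟨q, hq⟩ := exists_walk_corners hc m' 0
    refine ⟨p ++ q, walk_append_iff.2 ⟨_, (hπ₂.comp hπ₁).walk hp, ?_⟩⟩
    have := hπ₂.walk hq
    dsimp only at this
    rw [hm', ← hm] at this
    exact this

/-- A directed path in the dual graph of `X` lifts to a development. -/
theorem exists_chain {r r' : F} (h : Relation.TransGen
      (fun r r' => ∃ (i : ZMod (X.len r)) (j : ZMod (X.len r')), O.lower ⟨r, i⟩ ⟨r', j⟩) r r') :
    ∃ (Y : X.Development) (R R' : X.Polygon Y.S), R.1 = r ∧ R'.1 = r' ∧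
      Relation.TransGen (O.polygonAdj Y.faces) R R' ∧ ∃ p, Y.Walk (R.2 0) p (R'.2 0) := by
  induction h with
  | single h =>
    obtain ⟨i, j, h⟩ := h
    obtain ⟨Y, R, hR, rfl⟩ := exists_face (X := X) r
    obtain ⟨Y', π, hπ, R', hR', hadj, p, hp⟩ := exists_isHom_adjacent O hR h
    obtain ⟨q, hq⟩ := exists_walk_corners hR 0 i
    exact ⟨Y', R.map π, R', rfl, hR', .single hadj, q ++ p,
      walk_append_iff.2 ⟨_, hπ.walk hq, hp⟩⟩
  | tail _ h ih =>
    obtain ⟨i, j, h⟩ := h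
    obtain ⟨Y, R₀, R, h₀, rfl, hRR, q₀, hq₀⟩ := ih
    have hR := right_mem_of_transGen O hRR
    obtain ⟨Y', π, hπ, R', hR', hadj, p, hp⟩ := exists_isHom_adjacent O hR h
    obtain ⟨q, hq⟩ := exists_walk_corners hR 0 i
    exact ⟨Y', R₀.map π, R', h₀, hR', (hπ.transGen O hRR).tail hadj, q₀ ++ (q ++ p),
      walk_append_iff.2 ⟨_, hπ.walk hq₀, walk_append_iff.2 ⟨_, hπ.walk hq, hp⟩⟩⟩

/-- Some development contains a directed chain of 2-cells whose ends, both with label `r`, are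
joined by an edge path with label `p`. -/
def HasChain (r : F) (p : List (E × Bool)) : Prop :=
  ∃ (Y : X.Development) (c c' : ZMod (X.len r) → Y.S),
    Relation.TransGen (O.polygonAdj Y.faces) ⟨r, c⟩ ⟨r, c'⟩ ∧ Y.Walk (c 0) p (c' 0)

/-- Both kinds of elementary move insert a word `l` for which the ends of any walk labelled `l` can
be identified. To insert `l`, such a walk is grown and closed up; to delete `l`, the existing walk
is closed up. -/
theorem hasChain_iff_of_closes {r : F} {p l q : List (E × Bool)} {y : V}
    (hpath : X.toOneComplex.IsPath (X.toOneComplex.start (X.side r 0)) (p ++ l ++ q) y)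
    (hl : ∀ (Y : X.Development) (a b : Y.S), Y.Walk a l b →
      ∃ (Y' : X.Development) (π : Y.S → Y'.S), IsHom π ∧ π a = π b) :
    HasChain O r (p ++ q) ↔ HasChain O r (p ++ l ++ q) := by
  constructor
  · rintro ⟨Y, c, c', hc, hw⟩
    obtain ⟨b, hp, hq⟩ := walk_append_iff.1 hw
    obtain ⟨z, h1, h2⟩ := (OneComplex.isPath_append_iff _).1 hpath
    obtain ⟨z', h1, h2⟩ := (OneComplex.isPath_append_iff _).1 h1
    have hb : z' = Y.lab b := by
      have := hp.isPath
      rw [Y.lab_corner (left_mem_of_transGen O hc)] at this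
      exact h1.end_unique _ this
    obtain ⟨Y₁, π₁, hπ₁, b', hb'⟩ := Y.exists_isHom_walk b l z (hb ▸ h2)
    obtain ⟨Y₂, π₂, hπ₂, h⟩ := hl _ _ _ hb'
    refine ⟨Y₂, _, _, (hπ₂.comp hπ₁).transGen O hc, ?_⟩
    refine walk_append_iff.2 ⟨π₂ b', walk_append_iff.2 ⟨_, (hπ₂.comp hπ₁).walk hp,
      hπ₂.walk hb'⟩, ?_⟩
    rw [← h]
    exact (hπ₂.comp hπ₁).walk hq
  · rintro ⟨Y, c, c', hc, hw⟩
    obtain ⟨b', hw, hq⟩ := walk_append_iff.1 hw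
    obtain ⟨b, hp, hb⟩ := walk_append_iff.1 hw
    obtain ⟨Y₁, π₁, hπ₁, h⟩ := hl _ _ _ hb
    refine ⟨Y₁, _, _, hπ₁.transGen O hc, walk_append_iff.2 ⟨_, hπ₁.walk hp, ?_⟩⟩
    rw [h]
    exact hπ₁.walk hq

theorem hasChain_iff_of_homotopic {r : F} {x y : V}
    (hx : x = X.toOneComplex.start (X.side r 0)) {p q : List (E × Bool)}
    (h : X.Homotopic x y p q) : HasChain O r p ↔ HasChain O r q := by
  subst hx
  induction h with
  | refl => exact Iff.rfl
  | symm _ _ _ ih => exact ih.symm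
  | trans _ _ _ _ _ ih ih' => exact ih.trans ih'
  | rel p q h =>
    obtain ⟨-, hq, hins⟩ := h
    cases hins with
    | backtrack p q e b =>
      exact hasChain_iff_of_closes O hq fun Y _ _ h => Y.exists_isHom_backtrack h
    | cell p q r i =>
      refine hasChain_iff_of_closes O hq fun Y _ _ h => ?_
      obtain ⟨Y', π, hπ, h, -⟩ := Y.exists_isHom_cell h
      exact ⟨Y', π, hπ, h⟩

/-- A directed cycle in the dual graph of a simply connected complex lifts to a development. -/
theorem exists_cycle (hX : X.IsSimplyConnected) {r : F} (h : Relation.TransGen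
      (fun r r' => ∃ (i : ZMod (X.len r)) (j : ZMod (X.len r')), O.lower ⟨r, i⟩ ⟨r', j⟩) r r) :
    ∃ (Y : X.Development) (R : X.Polygon Y.S),
      Relation.TransGen (O.polygonAdj Y.faces) R R := by
  obtain ⟨Y, ⟨_, c⟩, ⟨_, c'⟩, rfl, h', hc, p, hp⟩ := exists_chain O h
  cases h'
  have hpath := hp.isPath
  rw [Y.lab_corner (left_mem_of_transGen O hc), Y.lab_corner (right_mem_of_transGen O hc)] at hpath
  obtain ⟨Y₁, d, d', hd, hw⟩ :=
    (hasChain_iff_of_homotopic O rfl (hX.2.2 _ p hpath)).1 ⟨Y, c, c', hc, hp⟩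
  -- The empty path puts both end cells at the same corner `0`; folding them turns the chain into a
  -- cycle.
  obtain ⟨Y₂, π, hπ, hdd, -⟩ := Y₁.exists_isHom_fold (left_mem_of_transGen O hd)
    (right_mem_of_transGen O hd) (walk_nil_iff.1 hw)
  refine ⟨Y₂, Polygon.map π ⟨_, d⟩, ?_⟩
  have := hπ.transGen O hd
  unfold Polygon.map at this
  dsimp only at this
  rw [← hdd] at this
  exact this

end Development

end TwoComplex

/-! ### Counting topmost sides and corners -/

namespace TwoComplex

variable {V : Type u} {E : Type v} {F : Type w} {X : TwoComplex V E F}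

namespace Development

variable (Y : X.Development)

/-- The sides of the 2-cells of a development, and the corners where they begin. -/
abbrev FaceSide := Σ R : Y.faces, ZMod (X.len R.1.1)

instance : Finite Y.faces := Y.finite_faces

noncomputable instance : Fintype Y.faces := Fintype.ofFinite _

variable {Y}

/-- The side of `X` that labels a side of a development. -/
def label (s : Y.FaceSide) : X.Side := ⟨s.1.1.1, s.2⟩

/-- The 1-cell under a side. -/
def sideEdge (s : Y.FaceSide) : Y.S × E × Y.S := s.1.1.edge s.2

/-- The 0-cell at a corner. -/
def corner (s : Y.FaceSide) : Y.S := s.1.1.2 s.2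

/-- The side after a given one. -/
def next (s : Y.FaceSide) : Y.FaceSide := ⟨s.1, s.2 + 1⟩

theorem exists_ends (s : Y.FaceSide) : ∃ t t' : Y.FaceSide,
    label t = X.sourceCorner (label s) ∧ label t' = X.targetCorner (label s) ∧
      sideEdge s = (corner t, X.under (label s), corner t') ∧
      (t = s ∧ t' = next s ∨ t = next s ∧ t' = s) := by
  unfold sourceCorner targetCorner
  cases h : (X.side (label s).1 (label s).2).2 with
  | true =>
    refine ⟨s, next s, rfl, rfl, ?_, .inl ⟨rfl, rfl⟩⟩
    exact if_pos h
  | false =>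
    refine ⟨next s, s, rfl, rfl, ?_, .inr ⟨rfl, rfl⟩⟩
    exact if_neg (fun h' => Bool.false_ne_true (h.symm.trans h'))

theorem under_label {s s' : Y.FaceSide} (h : sideEdge s = sideEdge s') :
    X.under (label s) = X.under (label s') := by
  obtain ⟨_, _, -, -, h1, -⟩ := exists_ends s
  obtain ⟨_, _, -, -, h2, -⟩ := exists_ends s'
  rw [h1, h2] at h
  exact congrArg (fun x => x.2.1) h

variable (Y) in
/-- Distinct 2-cells with the same label have no corner in common. -/
def IsImmersed : Prop :=
  ∀ (r : F) (c c' : ZMod (X.len r) → Y.S), (⟨r, c⟩ : X.Polygon Y.S) ∈ Y.faces →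
    (⟨r, c'⟩ : X.Polygon Y.S) ∈ Y.faces → ∀ i, c i = c' i → c = c'

theorem IsImmersed.eq_of_label_eq (hY : Y.IsImmersed) {s s' : Y.FaceSide}
    (hl : label s = label s') (hc : corner s = corner s') : s = s' := by
  obtain ⟨⟨⟨r, c⟩, hR⟩, i⟩ := s
  obtain ⟨⟨⟨r', c'⟩, hR'⟩, i'⟩ := s'
  obtain ⟨rfl, hi⟩ := Sigma.mk.inj hl
  obtain rfl := eq_of_heq hi
  obtain rfl := hY _ c c' hR hR' i hc
  rfl

/-- Equally labelled sides over one 1-cell have equally labelled corners at its source, so they lie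
on the same 2-cell, where the label fixes the position. -/
theorem IsImmersed.eq_of_sideEdge_eq (hY : Y.IsImmersed) {s s' : Y.FaceSide}
    (hl : label s = label s') (h : sideEdge s = sideEdge s') : s = s' := by
  obtain ⟨t, _, h1, -, h2, h3⟩ := exists_ends s
  obtain ⟨t', _, h1', -, h2', h3'⟩ := exists_ends s'
  rw [h2, h2'] at h
  have := hY.eq_of_label_eq (h1.trans ((congrArg _ hl).trans h1'.symm)) (congrArg Prod.fst h)
  subst this
  refine hY.eq_of_label_eq hl ?_
  obtain ⟨⟨R, hR⟩, i⟩ := s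
  obtain ⟨⟨R', hR'⟩, i'⟩ := s'
  have hfst : (⟨R, hR⟩ : Y.faces) = ⟨R', hR'⟩ := by
    have e1 : t.1 = ⟨R, hR⟩ := by rcases h3 with h | h <;> exact congrArg Sigma.fst h.1
    have e2 : t.1 = ⟨R', hR'⟩ := by rcases h3' with h | h <;> exact congrArg Sigma.fst h.1
    exact e1.symm.trans e2
  cases hfst
  have : i = i' := by simpa [label] using hl
  rw [this]

variable (O : X.SideOrder)

/-- No side over the same 1-cell is higher. -/
def IsTopSide (s : Y.FaceSide) : Prop :=
  ∀ s', sideEdge s = sideEdge s' → ¬ O.lower (label s) (label s')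

/-- No corner at the same 0-cell is higher. -/
def IsTopCorner (s : Y.FaceSide) : Prop :=
  ∀ s', corner s = corner s' → O.height (label s') ≤ O.height (label s)

variable {O}

/-- A higher side over the same 1-cell would have a higher corner at each end, in particular at the
0-cell of `t`. -/
theorem IsTopCorner.isTopSide_of_next {s t : Y.FaceSide} (ht : IsTopCorner O t)
    (h : t = s ∨ t = next s) : IsTopSide O s := by
  intro s' he hl
  obtain ⟨a, b, ha, hb, h1, h2⟩ := exists_ends s
  obtain ⟨a', b', ha', hb', h1', -⟩ := exists_ends s'
  have hs := O.height_source hl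
  have htg := O.height_target hl
  rw [← ha, ← ha'] at hs
  rw [← hb, ← hb'] at htg
  rw [h1, h1'] at he
  have : t = a ∨ t = b := by
    rcases h2 with ⟨rfl, rfl⟩ | ⟨rfl, rfl⟩
    exacts [h, h.symm]
  rcases this with rfl | rfl
  · exact (ht a' (congrArg Prod.fst he)).not_gt hs
  · exact (ht b' (congrArg (fun x => x.2.2) he)).not_gt htg

theorem exists_isTopCorner (s : Y.FaceSide) : ∃ t, IsTopCorner O t ∧ corner t = corner s := by
  obtain ⟨t, ht, hmax⟩ := Set.exists_max_image {t : Y.FaceSide | corner t = corner s}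
    (fun t => O.height (label t)) (Set.toFinite _) ⟨s, rfl⟩
  exact ⟨t, fun t' h => hmax t' (h.symm.trans ht), ht⟩

theorem IsImmersed.isTopSide_injOn (hY : Y.IsImmersed) :
    Set.InjOn sideEdge {s : Y.FaceSide | IsTopSide O s} := by
  intro s hs s' hs' h
  by_contra hne
  rcases O.total (fun hl => hne (hY.eq_of_sideEdge_eq hl h)) (under_label h) with hl | hl
  · exact hs s' h hl
  · exact hs' s h.symm hl

/-- If every topmost side began at a topmost corner, the side before it would be topmost too. Going
backwards from a highest side, which goodness provides, all sides would be topmost. -/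
theorem exists_isTopSide_not_isTopCorner {R : Y.faces} (hR : ∃ j, ¬ IsTopSide O (Y := Y) ⟨R, j⟩) :
    ∃ j, IsTopSide O (Y := Y) ⟨R, j⟩ ∧ ¬ IsTopCorner O (Y := Y) ⟨R, j⟩ := by
  by_contra! hcon
  obtain ⟨j, hj⟩ := hR
  obtain ⟨i, hi⟩ := O.exists_highest R.1.1
  refine hj ?_
  -- The sign makes the forward induction run backwards around the boundary.
  have := zmod_induction (P := fun j => IsTopSide O (Y := Y) ⟨R, -j⟩) (-i)
    (by rw [neg_neg]; exact fun s' _ => hi _) (fun k hk => ?_) (-j)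
  · rwa [neg_neg] at this
  · refine (hcon _ hk).isTopSide_of_next (.inr ?_)
    unfold next
    congr 1
    ring

/-- Each 2-cell that is not highest throughout contributes to the excess of highest sides over
highest corners. -/
theorem IsImmersed.card_le (hY : Y.IsImmersed)
    (h : ∀ R : Y.faces, ∃ j, ¬ IsTopSide O (Y := Y) ⟨R, j⟩) :
    (Set.range (corner (Y := Y))).ncard + Nat.card Y.faces ≤
      (Set.range (sideEdge (Y := Y))).ncard := by
  choose j hj hj' using fun R => exists_isTopSide_not_isTopCorner (h R)
  let φ : Y.faces → Y.FaceSide := fun R => ⟨R, j R⟩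
  have hφ : Function.Injective φ := fun R R' h => congrArg Sigma.fst h
  calc (Set.range (corner (Y := Y))).ncard + Nat.card Y.faces
      ≤ {s : Y.FaceSide | IsTopCorner O s}.ncard + (Set.range φ).ncard := by
        refine add_le_add ?_ ?_
        · refine (Set.ncard_le_ncard ?_).trans (Set.ncard_image_le (f := corner))
          rintro _ ⟨s, rfl⟩
          obtain ⟨t, ht, hs⟩ := exists_isTopCorner (O := O) s
          exact ⟨t, ht, hs⟩
        · rw [← Set.image_univ, Set.ncard_image_of_injective _ hφ, Set.ncard_univ]
    -- The sides chosen for the 2-cells begin at corners that are not topmost, so they are new.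
    _ = ({s : Y.FaceSide | IsTopCorner O s} ∪ Set.range φ).ncard := by
        rw [Set.ncard_union_eq]
        rw [Set.disjoint_right]
        rintro _ ⟨R, rfl⟩
        exact hj' R
    _ ≤ {s : Y.FaceSide | IsTopSide O s}.ncard := by
        refine Set.ncard_le_ncard ?_
        rintro _ (hs | ⟨R, rfl⟩)
        · exact IsTopCorner.isTopSide_of_next hs (.inl rfl)
        · exact hj R
    _ = (sideEdge '' {s : Y.FaceSide | IsTopSide O s}).ncard :=
        hY.isTopSide_injOn.ncard_image.symm
    _ ≤ _ := Set.ncard_le_ncard (Set.image_subset_range _ _)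

/-! ### Euler characteristic, collapses and the induction -/

/-- The Euler characteristic of the subcomplex covered by the 2-cells is positive. -/
theorem card_sideEdge_lt (Y : X.Development) (R₀ : Y.faces) :
    (Set.range (sideEdge (Y := Y))).ncard <
      (Set.range (corner (Y := Y))).ncard + Nat.card Y.faces := by
  classical
  let Ec := Set.range (sideEdge (Y := Y))
  let Vc := Set.range (corner (Y := Y))
  have hsrc : ∀ x : Ec, x.1.1 ∈ Vc := by
    rintro ⟨_, s, rfl⟩
    obtain ⟨t, t', -, -, h, -⟩ := exists_ends s
    exact ⟨t, (congrArg Prod.fst h).symm⟩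
  have htgt : ∀ x : Ec, x.1.2.2 ∈ Vc := by
    rintro ⟨_, s, rfl⟩
    obtain ⟨t, t', -, -, h, -⟩ := exists_ends s
    exact ⟨t', (congrArg (fun x => x.2.2) h).symm⟩
  have : Fintype Ec := Fintype.ofFinite _
  have : Fintype Vc := Fintype.ofFinite _
  let D₁ : (Ec → ZMod 2) →ₗ[ZMod 2] (Y.faces → ZMod 2) :=
    LinearMap.pi fun R => ∑ j, LinearMap.proj (⟨sideEdge ⟨R, j⟩, ⟨_, rfl⟩⟩ : Ec)
  let D₀ : (Vc → ZMod 2) →ₗ[ZMod 2] (Ec → ZMod 2) :=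
    LinearMap.pi fun x => LinearMap.proj ⟨_, htgt x⟩ - LinearMap.proj ⟨_, hsrc x⟩
  have hker : LinearMap.ker D₁ ≤ LinearMap.range D₀ := by
    intro f hf
    -- Extension by zero is harmless, since the cocycle condition only sees 1-cells traversed by
    -- 2-cells.
    obtain ⟨g, hg⟩ := Y.exact (fun x => if h : x ∈ Ec then f ⟨x, h⟩ else 0) fun R hR => by
      have := congrFun (LinearMap.mem_ker.1 hf) ⟨R, hR⟩
      simp only [D₁, LinearMap.pi_apply, LinearMap.sum_apply, LinearMap.proj_apply,
        Pi.zero_apply] at this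
      rw [← this]
      refine Finset.sum_congr rfl fun j _ => ?_
      exact dif_pos ⟨(⟨⟨R, hR⟩, j⟩ : Y.FaceSide), rfl⟩
    refine ⟨fun a => g a, ?_⟩
    ext ⟨x, s, rfl⟩
    have := hg _ (Y.face_edge s.1.1 s.1.2 s.2)
    exact this.symm.trans (dif_pos ⟨s, rfl⟩)
  have h1 := LinearMap.finrank_range_add_finrank_ker D₁
  have h2 := LinearMap.finrank_range_add_finrank_ker D₀
  have h3 := Submodule.finrank_le (LinearMap.range D₁)
  have h4 := Submodule.finrank_mono hker
  -- The constant 1 is a nonzero 0-cocycle, as `R₀` has a corner; connectedness is not needed.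
  have h5 : 0 < Module.finrank (ZMod 2) (LinearMap.ker D₀) := by
    have : Nontrivial (LinearMap.ker D₀) := by
      refine ⟨⟨⟨1, ?_⟩, 0, ?_⟩⟩
      · ext x
        simp [D₀]
      · intro h
        have := congrFun (congrArg Subtype.val h) ⟨_, (⟨R₀, 0⟩ : Y.FaceSide), rfl⟩
        simp at this
    exact Module.finrank_pos
  simp only [Module.finrank_fintype_fun_eq_card] at h1 h2 h3
  rw [Set.ncard_eq_toFinset_card', Set.ncard_eq_toFinset_card', Set.toFinset_card,
    Set.toFinset_card, Nat.card_eq_fintype_card]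
  change Fintype.card Ec < Fintype.card Vc + _
  -- E = rk `D₁` + dim ker `D₁` ≤ F + rk `D₀` = F + V - dim ker `D₀` < F + V.
  omega

/-- A 2-cell can be removed together with a 1-cell that it alone traverses, and only once. -/
def eraseFace (Y : X.Development) (s : Y.FaceSide)
    (hs : ∀ s', sideEdge s' = sideEdge s → s' = s) : X.Development where
  S := Y.S
  lab := Y.lab
  edges := Y.edges \ {sideEdge s}
  faces := Y.faces \ {s.1.1}
  finite_faces := Y.finite_faces.sdiff
  lab_edge x hx := Y.lab_edge x hx.1
  face_edge := by
    intro R hR j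
    refine ⟨Y.face_edge R hR.1 j, fun h => hR.2 ?_⟩
    exact congrArg (fun t : Y.FaceSide => t.1.1) (hs ⟨⟨R, hR.1⟩, j⟩ h)
  exact := by
    classical
    intro f hf
    -- Changing `f` on the free 1-cell by its sum around the removed 2-cell makes that sum vanish
    -- mod 2 and affects no other 2-cell.
    obtain ⟨g, hg⟩ := Y.exact
      (fun x => f x + if x = sideEdge s then ∑ j, f (s.1.1.edge j) else 0) fun R hR => by
        rw [Finset.sum_add_distrib]
        by_cases h : R = s.1.1
        · subst h
          have : ∀ j, (s.1.1.edge j = sideEdge s) ↔ j = s.2 := by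
            intro j
            constructor
            · intro h
              exact eq_of_heq (Sigma.mk.inj (hs ⟨s.1, j⟩ h)).2
            · rintro rfl
              rfl
          simp [this, CharTwo.add_self_eq_zero]
        · have : ∀ j, R.edge j ≠ sideEdge s := fun j hj =>
            h (congrArg (fun t : Y.FaceSide => t.1.1) (hs ⟨⟨R, hR⟩, j⟩ hj))
          simp [this, hf R ⟨hR, h⟩]
    refine ⟨g, fun x hx => ?_⟩
    have := hg x hx.1
    rwa [if_neg (show x ≠ sideEdge s from hx.2), add_zero] at this

/-- A 2-cell without outgoing edges can only be the end of a directed path. -/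
theorem transGen_diff {S : Type*} {A : Set (X.Polygon S)} {R₀ R R' : X.Polygon S}
    (h₀ : ∀ R, ¬ O.polygonAdj A R₀ R) (h : Relation.TransGen (O.polygonAdj A) R R')
    (hR' : R' ≠ R₀) : Relation.TransGen (O.polygonAdj (A \ {R₀})) R R' := by
  have key : ∀ {P Q}, O.polygonAdj A P Q → Q ≠ R₀ → O.polygonAdj (A \ {R₀}) P Q := by
    rintro P Q h hQ
    refine ⟨⟨h.1, ?_⟩, ⟨h.2.1, hQ⟩, h.2.2⟩
    rintro rfl
    exact h₀ _ h
  induction h with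
  | single h => exact .single (key h hR')
  | tail _ h ih =>
    refine (ih ?_).tail (key h hR')
    rintro rfl
    exact h₀ _ h

/-- The directed dual graph of a development is acyclic. -/
theorem not_transGen_polygonAdj (O : X.SideOrder) (Y : X.Development) (R : X.Polygon Y.S) :
    ¬ Relation.TransGen (O.polygonAdj Y.faces) R R := by
  induction hn : Y.faces.ncard using Nat.strong_induction_on generalizing Y with
  | _ n ih =>
  subst hn
  intro hR
  by_cases hY : Y.IsImmersed
  · by_cases htop : ∃ R : Y.faces, ∀ j, IsTopSide O (Y := Y) ⟨R, j⟩
    · obtain ⟨R₀, h₀⟩ := htop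
      have hout : ∀ R, ¬ O.polygonAdj Y.faces R₀ R := by
        rintro R' ⟨-, hR', j, j', he, hl⟩
        exact h₀ j ⟨⟨R', hR'⟩, j'⟩ he hl
      obtain ⟨i, hi⟩ := O.exists_lowest R₀.1.1
      -- Another side over this 1-cell would lie below a lowest side or above a topmost one.
      have hfree : ∀ s' : Y.FaceSide, sideEdge s' = sideEdge ⟨R₀, i⟩ → s' = ⟨R₀, i⟩ := by
        intro s' hs'
        by_contra hne
        rcases O.total (fun hl => hne (hY.eq_of_sideEdge_eq hl hs')) (under_label hs') with h | h
        · exact hi _ h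
        · exact h₀ i s' hs'.symm h
      refine ih _ (Set.ncard_sdiff_singleton_lt_of_mem R₀.2 Y.finite_faces)
        (Y.eraseFace ⟨R₀, i⟩ hfree) R rfl (transGen_diff hout hR ?_)
      rintro rfl
      obtain ⟨_, h, -⟩ := Relation.TransGen.head'_iff.1 hR
      exact hout _ h
    · push Not at htop
      exact (Y.card_sideEdge_lt ⟨R, left_mem_of_transGen O hR⟩).not_ge (hY.card_le htop)
  · unfold IsImmersed at hY
    push Not at hY
    obtain ⟨r, c, c', hc, hc', i, hi, hne⟩ := hY
    obtain ⟨Y', π, hπ, hcc, hfaces⟩ := Y.exists_isHom_fold hc hc' hi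
    refine ih _ ?_ Y' _ rfl (hπ.transGen O hR)
    rw [hfaces]
    -- The fold merges two distinct 2-cells, so their number drops.
    refine (Set.ncard_image_le Y.finite_faces).lt_of_ne fun h => hne ?_
    have := Set.injOn_of_ncard_image_eq h Y.finite_faces hc hc'
      (Sigma.ext rfl (heq_of_eq hcc))
    simpa using this

end Development

end TwoComplex

theorem mainTheorem2 {V : Type u} {E : Type v} {F : Type w} (X : TwoComplex V E F)
    (hX : X.IsSimplyConnected) (Ψ : X.Stacking) (hΨ : Ψ.IsGood) :
    Ψ.directedDual.IsAcyclic := by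
  intro r hr
  obtain ⟨Y, R, hR⟩ :=
    TwoComplex.Development.exists_cycle (Ψ.sideOrder hΨ) hX hr
  exact TwoComplex.Development.not_transGen_polygonAdj _ Y R hR
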